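/- Let $N,m\ge 0$ be integers. A 3XOR game with alphabet size $N$ and $m$ clauses is given by questions $a_i,b_i,c_i\in\{1,\dots,N\}$ and parity bits $s_i\in\{0,1\}$ for $1\le i\le m$. Let $G$ be the group with generators $\sigma$ and $x_i^{(\alpha)}$ ($1\le i\le N$, $\alpha\in\{1,2,3\}$) and relations $(x_i^{(\alpha)})^2=1$, $[x_i^{(\alpha)},x_j^{(\beta)}]=1$ for $\alpha\neq\beta$, $\sigma^2=1$ and $[\sigma,x_i^{(\alpha)}]=1$, where $[u,v]=uvu^{-1}v^{-1}$. Put $h_i=x_{a_i}^{(1)}x_{b_i}^{(2)}x_{c_i}^{(3)}\sigma^{s_i}$ for $1\le i\le m$, and let $$H=\langle h_i : 1\le i\le m\rangle,\qquad H^E=\langle h_ih_j : 1\le i,j\le m\rangle,$$ $$G^E=\langle\{x_i^{(\alpha)}x_j^{(\alpha)} : 1\le i,j\le N,\ \alpha\in\{1,2,3\}\}\cup\{\sigma\}\rangle,$$ which are subgroups of $G$ with $H^E\le G^E$. Let $K$ be the normal closure in $G^E$ of the set of all commutators $[x_i^{(\alpha)}x_j^{(\alpha)},\,x_k^{(\alpha)}x_l^{(\alpha)}]$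 with $1\le i,j,k,l\le N$ and $\alpha\in\{1,2,3\}$, and let $[\sigma]_K$ be the coset of $\sigma$ in $G^E/K$. Theorem. For every 3XOR game, the quotient group $G^E/K$ is abelian, and $$\sigma\in H\iff[\sigma]_K\in H^E\pmod K,$$ where $H^E \pmod K$ denotes the image of $H^E$ in $G^E/K$. -/

import Mathlib

/-- A 3XOR game with alphabet size `N` and `m` clauses: the `i`-th question vector is
`(a i, b i, c i)`, with parity bit `s i ∈ {0, 1}`; the players win that round when their three
answers sum to `s i` modulo 2.  The data are the system of equations
`X⁽¹⁾_{a i} + X⁽²⁾_{b i} + X⁽³⁾_{c i} = s i`, `i = 1, …, m`, modulo 2. -/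
structure ThreeXORGame (N m : ℕ) where
  /-- question sent to the first player -/
  a : Fin m → Fin N
  /-- question sent to the second player -/
  b : Fin m → Fin N
  /-- question sent to the third player -/
  c : Fin m → Fin N
  /-- parity bit -/
  s : Fin m → Fin 2

namespace ThreeXORGame

open scoped commutatorElement

/-- Formal generators of the game group: `x α i` for each player `α` and question `i`, and
`sigma`.  The players 1, 2, 3 are numbered 0, 1, 2 here. -/
inductive Gen (N : ℕ) where
  | x (α : Fin 3) (i : Fin N) : Gen N
  | sigma : Gen N

/-- The defining relations of the game group, as the set of words declared trivial. -/
def rels (N : ℕ) : Set (FreeGroup (Gen N)) :=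
  {w | ∃ (α : Fin 3) (i : Fin N), w = FreeGroup.of (Gen.x α i) ^ 2} ∪
  {w | ∃ (α β : Fin 3) (i j : Fin N), α ≠ β ∧
    w = ⁅(FreeGroup.of (Gen.x α i) : FreeGroup (Gen N)), FreeGroup.of (Gen.x β j)⁆} ∪
  {FreeGroup.of Gen.sigma ^ 2} ∪
  {w | ∃ (α : Fin 3) (i : Fin N),
    w = ⁅(FreeGroup.of Gen.sigma : FreeGroup (Gen N)), FreeGroup.of (Gen.x α i)⁆}

/-- The game group `G`. -/
abbrev GameGroup (N : ℕ) : Type := PresentedGroup (rels N)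

/-- The element `x_i^{(α)}` of `G`. -/
def x {N : ℕ} (α : Fin 3) (i : Fin N) : GameGroup N := PresentedGroup.of (Gen.x α i)

/-- The element `σ` of `G`. -/
def sigma (N : ℕ) : GameGroup N := PresentedGroup.of Gen.sigma

/-- The even subgroup `G^E` of `G`. -/
def evenGroup (N : ℕ) : Subgroup (GameGroup N) :=
  Subgroup.closure
    ({g | ∃ (α : Fin 3) (i j : Fin N), g = x α i * x α j} ∪ {sigma N})

theorem sigma_mem_evenGroup (N : ℕ) : sigma N ∈ evenGroup N :=
  Subgroup.subset_closure (Or.inr rfl)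

theorem x_mul_x_mem_evenGroup {N : ℕ} (α : Fin 3) (i j : Fin N) :
    x α i * x α j ∈ evenGroup N :=
  Subgroup.subset_closure (Or.inl ⟨α, i, j, rfl⟩)

/-- The element `x_i^{(α)} x_j^{(α)}`, as an element of `G^E`. -/
def evenPair {N : ℕ} (α : Fin 3) (i j : Fin N) : evenGroup N :=
  ⟨x α i * x α j, x_mul_x_mem_evenGroup α i j⟩

/-- The element `σ`, as an element of `G^E`. -/
def evenSigma (N : ℕ) : evenGroup N := ⟨sigma N, sigma_mem_evenGroup N⟩

/-- The even commutator subgroup `K`: the normal closure in `G^E` (not in `G`) of the commutators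
`⁅x_i^{(α)} x_j^{(α)}, x_k^{(α)} x_l^{(α)}⁆`. -/
def K (N : ℕ) : Subgroup (evenGroup N) :=
  Subgroup.normalClosure
    {g | ∃ (α : Fin 3) (i j k l : Fin N), g = ⁅evenPair α i j, evenPair α k l⁆}

instance K_normal (N : ℕ) : (K N).Normal := Subgroup.normalClosure_normal

variable {N m : ℕ} (Γ : ThreeXORGame N m)

/-- The clause `h_i = x_{a_i}^{(1)} x_{b_i}^{(2)} x_{c_i}^{(3)} σ^{s_i}`. -/
def clause (i : Fin m) : GameGroup N :=
  x 0 (Γ.a i) * x 1 (Γ.b i) * x 2 (Γ.c i) * sigma N ^ (Γ.s i : ℕ)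

/-- The clause group `H`, generated by the clauses. -/
def clauseGroup : Subgroup (GameGroup N) :=
  Subgroup.closure (Set.range Γ.clause)

/-- The even clause group `H^E`, generated by the products of two clauses. -/
def evenClauseGroup : Subgroup (GameGroup N) :=
  Subgroup.closure {g | ∃ i j : Fin m, g = Γ.clause i * Γ.clause j}

theorem commute_x {α β : Fin 3} (h : α ≠ β) (i j : Fin N) : Commute (x α i) (x β j) := by
  have key : PresentedGroup.mk (rels N)
      ⁅(FreeGroup.of (Gen.x α i) : FreeGroup (Gen N)), FreeGroup.of (Gen.x β j)⁆ = 1 :=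
    PresentedGroup.one_of_mem (Or.inl (Or.inl (Or.inr ⟨α, β, i, j, h, rfl⟩)))
  rw [map_commutatorElement] at key
  exact commutatorElement_eq_one_iff_commute.mp key

theorem commute_sigma_x (α : Fin 3) (i : Fin N) : Commute (sigma N) (x α i) := by
  have key : PresentedGroup.mk (rels N)
      ⁅(FreeGroup.of Gen.sigma : FreeGroup (Gen N)), FreeGroup.of (Gen.x α i)⁆ = 1 :=
    PresentedGroup.one_of_mem (Or.inr ⟨α, i, rfl⟩)
  rw [map_commutatorElement] at key
  exact commutatorElement_eq_one_iff_commute.mp key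

/-- `H^E` is contained in `G^E`, so that its image in `G^E / K` makes sense. -/
theorem evenClauseGroup_le_evenGroup : Γ.evenClauseGroup ≤ evenGroup N := by
  refine (Subgroup.closure_le _).mpr ?_
  rintro _ ⟨i, j, rfl⟩
  have key : Γ.clause i * Γ.clause j =
      (x 0 (Γ.a i) * x 0 (Γ.a j)) * (x 1 (Γ.b i) * x 1 (Γ.b j)) *
        (x 2 (Γ.c i) * x 2 (Γ.c j)) * (sigma N ^ (Γ.s i : ℕ) * sigma N ^ (Γ.s j : ℕ)) := by
    have hσ : ∀ (α : Fin 3) (k : Fin N),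
        Commute (sigma N ^ (Γ.s i : ℕ)) (x α k) := fun α k => (commute_sigma_x α k).pow_left _
    unfold clause
    have h10 := (commute_x (show (1 : Fin 3) ≠ 0 by decide) (Γ.b i) (Γ.a j)).eq
    have h20 := (commute_x (show (2 : Fin 3) ≠ 0 by decide) (Γ.c i) (Γ.a j)).eq
    have h21 := (commute_x (show (2 : Fin 3) ≠ 1 by decide) (Γ.c i) (Γ.b j)).eq
    calc _ = x 0 (Γ.a i) * x 1 (Γ.b i) * x 2 (Γ.c i) *
          (sigma N ^ (Γ.s i : ℕ) * (x 0 (Γ.a j) * x 1 (Γ.b j) * x 2 (Γ.c j))) *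
          sigma N ^ (Γ.s j : ℕ) := by simp only [mul_assoc]
      _ = x 0 (Γ.a i) * (x 1 (Γ.b i) * (x 2 (Γ.c i) * x 0 (Γ.a j)) * x 1 (Γ.b j)) *
          x 2 (Γ.c j) * (sigma N ^ (Γ.s i : ℕ) * sigma N ^ (Γ.s j : ℕ)) := by
        rw [(((hσ 0 (Γ.a j)).mul_right (hσ 1 (Γ.b j))).mul_right (hσ 2 (Γ.c j))).eq]
        simp only [mul_assoc]
      _ = x 0 (Γ.a i) * ((x 1 (Γ.b i) * x 0 (Γ.a j)) * (x 2 (Γ.c i) * x 1 (Γ.b j))) *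
          x 2 (Γ.c j) * (sigma N ^ (Γ.s i : ℕ) * sigma N ^ (Γ.s j : ℕ)) := by
        rw [h20]; simp only [mul_assoc]
      _ = _ := by rw [h10, h21]; simp only [mul_assoc]
  have hs := sigma_mem_evenGroup N
  rw [key]
  exact mul_mem (mul_mem (mul_mem (x_mul_x_mem_evenGroup _ _ _) (x_mul_x_mem_evenGroup _ _ _))
    (x_mul_x_mem_evenGroup _ _ _)) (mul_mem (pow_mem hs _) (pow_mem hs _))

/-- `H^E`, as a subgroup of `G^E`. -/
def evenClauseSubgroup : Subgroup (evenGroup N) := Γ.evenClauseGroup.subgroupOf (evenGroup N)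

/-- `H^E (mod K)`: the image of `H^E` in the quotient group `G^E / K`. -/
def evenClauseModK : Subgroup (evenGroup N ⧸ K N) :=
  Γ.evenClauseSubgroup.map (QuotientGroup.mk' (K N))

end ThreeXORGame

/-! If σ lies in H it already lies in H^E, because clauses are involutions and a parity character
separates odd products of clauses from σ; reducing modulo K gives one direction.

Conversely, let σ ≡ g modulo K with g in H^E. Letting one player's generators act on ℤ by
reflections turns g into a translation and K into the identity. This gives integers z_i, one per
clause, whose sum over the clauses asking any given player any given question is 0, while ∑ z_i s_i
is odd. It remains to order the clauses so that all three players' words cancel without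
commutativity.

Let F be free on the clauses, the i-th generator standing for h_o h_i with o a fixed clause. For
each player let A, B, C be the normal subgroups of F that kill the generator o and identify clauses
with the same question; the quotients are free. A word with exponents z lies in each of [F,F]A,
[F,F]B, [F,F]C, and a word of A ∩ B ∩ C with the same exponents is wanted. The engine is the
inclusion [X,X] ∩ N ≤ [X,N] for X normal, XN = F and F/N free
(`Subgroup.commutator_inf_le_of_retraction`). It corrects the word for two players, and for the
third when ABC = F (`FreeGroup.exists_mem_inf_inf_identify`). That condition says the game is
connected, so the argument runs on one connected component. -/

/-! ### Commutators of normal subgroups -/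

section GroupTheory

open scoped commutatorElement

variable {L : Type*} [Group L]

/-- If `N` has a complement in the sense that `e` is an endomorphism into `X` which kills `N` and is
the identity modulo `N`, then `N` meets the commutator subgroup of `X` only in `⁅X, N⁆`. -/
theorem Subgroup.commutator_inf_le_of_retraction (X N : Subgroup L) [X.Normal] [N.Normal]
    (e : L →* L) (heX : ∀ l, e l ∈ X) (heN : ∀ l, l * (e l)⁻¹ ∈ N) (he1 : ∀ n ∈ N, e n = 1) :
    ⁅X, X⁆ ⊓ N ≤ ⁅X, N⁆ := by
  let q := QuotientGroup.mk' ⁅X, N⁆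
  have hcomm : ∀ u ∈ X, ∀ n ∈ N, Commute (q u) (q n) := by
    intro u hu n hn
    rw [← commutatorElement_eq_one_iff_commute, ← map_commutatorElement]
    exact (QuotientGroup.eq_one_iff _).2 (Subgroup.commutator_mem_commutator hu hn)
  have hq : ∀ l, q l = q (l * (e l)⁻¹) * q (e l) := fun l => by rw [← map_mul]; simp
  -- Modulo ⁅X, N⁆ the factor u * (e u)⁻¹ commutes with the image of X, so a commutator of elements
  -- of X is unchanged when both entries are replaced by their images under `e`.
  have key : ⁅X, X⁆ ≤ q.eqLocus (q.comp e) := by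
    rw [Subgroup.commutator_le]
    intro u hu v hv
    change q ⁅u, v⁆ = q (e ⁅u, v⁆)
    have hun : u * (e u)⁻¹ ∈ X := X.mul_mem hu (X.inv_mem (heX u))
    have hcu : ∀ t ∈ X, Commute (q (u * (e u)⁻¹)) (q t) := fun t ht =>
      (hcomm t ht _ (heN u)).symm
    have hcv : ∀ t ∈ X, Commute (q (v * (e v)⁻¹)) (q t) := fun t ht =>
      (hcomm t ht _ (heN v)).symm
    have h1 : ⁅q u, q v⁆ = ⁅q (e u), q v⁆ := by
      rw [hq u, commutatorElement_def, commutatorElement_def]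
      have := (hcu v hv).eq
      have h2 := (hcu (e u) (heX u)).eq
      set n := q (u * (e u)⁻¹)
      calc n * q (e u) * q v * (n * q (e u))⁻¹ * (q v)⁻¹
          = q (e u) * (n * q v) * (q (e u) * n)⁻¹ * (q v)⁻¹ := by rw [h2]; group
        _ = _ := by rw [this]; group
    have h3 : ⁅q (e u), q v⁆ = ⁅q (e u), q (e v)⁆ := by
      rw [hq v, commutatorElement_def, commutatorElement_def]
      have := (hcv (e u) (heX u)).eq
      set n := q (v * (e v)⁻¹)
      calc q (e u) * (n * q (e v)) * (q (e u))⁻¹ * (n * q (e v))⁻¹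
          = (q (e u) * n) * q (e v) * (q (e u))⁻¹ * (q (e v))⁻¹ * n⁻¹ := by group
        _ = n * (q (e u) * q (e v) * (q (e u))⁻¹ * (q (e v))⁻¹) * n⁻¹ := by rw [← this]; group
        _ = _ := by
          have h4 : Commute n (q (e u) * q (e v) * (q (e u))⁻¹ * (q (e v))⁻¹) :=
            (((hcv _ (heX u)).mul_right (hcv _ (heX v))).mul_right
              (hcv _ (heX u)).inv_right).mul_right (hcv _ (heX v)).inv_right
          rw [h4.eq]; group
    rw [map_commutatorElement, map_commutatorElement, map_commutatorElement, h1, h3]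
  rintro w ⟨hw, hwN⟩
  have h := key hw
  change q w = q (e w) at h
  rw [he1 w hwN, map_one] at h
  exact (QuotientGroup.eq_one_iff _).1 h

/-- Bilinearity of commutators of normal subgroups, as an upper bound. -/
theorem Subgroup.commutator_sup_le (A B C : Subgroup L) [A.Normal] [B.Normal] [C.Normal] :
    ⁅A, B ⊔ C⁆ ≤ ⁅A, B⁆ ⊔ ⁅A, C⁆ := by
  rw [Subgroup.commutator_le]
  intro u hu v hv
  obtain ⟨b, hb, c, hc, rfl⟩ := Subgroup.mem_sup_of_normal_left.1 hv
  have : ⁅u, b * c⁆ = ⁅u, b⁆ * (b * ⁅u, c⁆ * b⁻¹) := by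
    simp only [commutatorElement_def]; group
  rw [this]
  exact Subgroup.mul_mem_sup (Subgroup.commutator_mem_commutator hu hb)
    (Subgroup.Normal.conj_mem inferInstance _ (Subgroup.commutator_mem_commutator hu hc) _)

end GroupTheory

/-! ### Free quotients of a free group and their kernels -/

namespace FreeGroup

variable {ι : Type*}

/-- The normal subgroup killing the generator `o` and identifying the generators in each class of
the equivalence relation `r`; the quotient by it is free. -/
def identify (o : ι) (r : Setoid ι) : Subgroup (FreeGroup ι) :=
  Subgroup.normalClosure ({of o} ∪ {g | ∃ i j, r i j ∧ g = (of i)⁻¹ * of j})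

instance (o : ι) (r : Setoid ι) : (identify o r).Normal := Subgroup.normalClosure_normal

theorem of_mem_identify (o : ι) (r : Setoid ι) : of o ∈ identify o r :=
  Subgroup.subset_normalClosure (Or.inl rfl)

theorem inv_mul_mem_identify (o : ι) {r : Setoid ι} {i j : ι} (h : r i j) :
    (of i)⁻¹ * of j ∈ identify o r :=
  Subgroup.subset_normalClosure (Or.inr ⟨i, j, h, rfl⟩)

theorem identify_le_ker {o : ι} {r : Setoid ι} {M : Type*} [Group M] (f : FreeGroup ι →* M)
    (ho : f (of o) = 1) (hr : ∀ i j, r i j → f (of i) = f (of j)) : identify o r ≤ f.ker := by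
  refine Subgroup.normalClosure_le_normal ?_
  rintro _ (rfl | ⟨i, j, hij, rfl⟩)
  · exact ho
  · simp [MonoidHom.mem_ker, hr i j hij]

theorem identify_mono (o : ι) {r s : Setoid ι} (h : r ≤ s) : identify o r ≤ identify o s := by
  refine Subgroup.normalClosure_le_normal ?_
  rintro _ (rfl | ⟨i, j, hij, rfl⟩)
  · exact of_mem_identify _ _
  · exact inv_mul_mem_identify _ (h hij)

theorem identify_sup (o : ι) (r s : Setoid ι) :
    identify o (r ⊔ s) = identify o r ⊔ identify o s := by
  apply le_antisymm
  · have hker : identify o r ⊔ identify o s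
        = (QuotientGroup.mk' (identify o r ⊔ identify o s)).ker :=
      (QuotientGroup.ker_mk' _).symm
    rw [hker]
    set q := QuotientGroup.mk' (identify o r ⊔ identify o s)
    have hq : ∀ i j, (of i)⁻¹ * of j ∈ identify o r ⊔ identify o s → q (of i) = q (of j) :=
      fun i j h => QuotientGroup.eq.2 h
    -- Having equal images in the quotient is an equivalence relation containing r and s, hence
    -- their join.
    have hle : r ⊔ s ≤ Setoid.ker fun i => q (of i) := sup_le
      (fun i j h => hq i j (le_sup_left (a := identify o r) (inv_mul_mem_identify o h)))
      (fun i j h => hq i j (le_sup_right (a := identify o r) (inv_mul_mem_identify o h)))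
    exact identify_le_ker q
      ((QuotientGroup.eq_one_iff _).2 (le_sup_left (a := identify o r) (of_mem_identify o r)))
      (fun i j h => hle h)
  · exact sup_le (identify_mono o le_sup_left) (identify_mono o le_sup_right)

theorem identify_top (o : ι) : identify o ⊤ = ⊤ := by
  rw [eq_top_iff, ← FreeGroup.closure_range_of, Subgroup.closure_le]
  rintro _ ⟨i, rfl⟩
  have h := mul_mem (of_mem_identify o ⊤) (inv_mul_mem_identify o (r := ⊤) (i := o) (j := i) trivial)
  rwa [mul_inv_cancel_left] at h

/-- Freeness of the quotient by `identify o r`: it lifts to any complementary subgroup `X`. -/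
theorem exists_retraction (o : ι) (r : Setoid ι) (X : Subgroup (FreeGroup ι))
    (hX : X ⊔ identify o r = ⊤) :
    ∃ e : FreeGroup ι →* FreeGroup ι, (∀ l, e l ∈ X) ∧ (∀ l, l * (e l)⁻¹ ∈ identify o r) ∧
      ∀ n ∈ identify o r, e n = 1 := by
  have hex : ∀ i : ι, ∃ t ∈ X, of i * t⁻¹ ∈ identify o r := by
    intro i
    have hi : of i ∈ X ⊔ identify o r := by rw [hX]; trivial
    rw [sup_comm] at hi
    obtain ⟨n, hn, t, ht, h⟩ := Subgroup.mem_sup_of_normal_left.1 hi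
    exact ⟨t, ht, by rwa [← h, mul_inv_cancel_right]⟩
  choose t htX htN using hex
  let rep : ι → ι := fun i => (Quotient.mk r i).out
  have hrep : ∀ i, r (rep i) i := fun i => Quotient.mk_out i
  -- The left factor makes `e` kill `of o` exactly; it is harmless modulo `identify o r`, where t
  -- (rep o) is trivial.
  let e : FreeGroup ι →* FreeGroup ι := lift fun i => (t (rep o))⁻¹ * t (rep i)
  have he : ∀ i, e (of i) = (t (rep o))⁻¹ * t (rep i) := fun i => lift_apply_of
  refine ⟨e, ?_, ?_, ?_⟩
  · have : (⊤ : Subgroup (FreeGroup ι)) ≤ X.comap e := by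
      rw [← FreeGroup.closure_range_of, Subgroup.closure_le]
      rintro _ ⟨i, rfl⟩
      change e (of i) ∈ X
      rw [he]
      exact mul_mem (inv_mem (htX _)) (htX _)
    exact fun l => this trivial
  · let q := QuotientGroup.mk' (identify o r)
    have hqt : ∀ i, q (t (rep i)) = q (of i) := by
      intro i
      have h1 : q (of (rep i) * (t (rep i))⁻¹) = 1 := (QuotientGroup.eq_one_iff _).2 (htN _)
      have h2 : q (of (rep i)) = q (of i) := QuotientGroup.eq.2 (inv_mul_mem_identify o (hrep i))
      rw [_root_.map_mul, _root_.map_inv, mul_inv_eq_one, h2] at h1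
      exact h1.symm
    have hqo : q (of o) = 1 := (QuotientGroup.eq_one_iff _).2 (of_mem_identify o r)
    have hqe : q.comp e = q := by
      ext i
      simp [he, hqt, hqo]
    intro l
    refine (QuotientGroup.eq_one_iff _).1 ?_
    change q (l * (e l)⁻¹) = 1
    rw [_root_.map_mul, _root_.map_inv, mul_inv_eq_one]
    exact (DFunLike.congr_fun hqe l).symm
  · intro n hn
    refine identify_le_ker e (by simp [he]) (fun i j hij => ?_) hn
    have : rep i = rep j := congrArg Quotient.out (Quotient.sound hij)
    rw [he, he, this]

theorem commutator_inf_identify_le (o : ι) (r : Setoid ι) (X : Subgroup (FreeGroup ι)) [X.Normal]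
    (hX : X ⊔ identify o r = ⊤) : ⁅X, X⁆ ⊓ identify o r ≤ ⁅X, identify o r⁆ := by
  obtain ⟨e, h1, h2, h3⟩ := exists_retraction o r X hX
  exact Subgroup.commutator_inf_le_of_retraction X _ e h1 h2 h3

/-- An element of the first subgroup that is trivial modulo commutators and the second can be moved
into the intersection by a commutator. -/
theorem exists_mem_inf_identify (o : ι) (r s : Setoid ι) {w : FreeGroup ι}
    (hr : w ∈ commutator (FreeGroup ι) ⊔ identify o r)
    (hs : w ∈ commutator (FreeGroup ι) ⊔ identify o s) :
    ∃ k ∈ commutator (FreeGroup ι), k * w ∈ identify o r ⊓ identify o s := by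
  obtain ⟨l, hl, u, hu, rfl⟩ := Subgroup.mem_sup_of_normal_left.1 hr
  obtain ⟨l', hl', v, hv, h⟩ := Subgroup.mem_sup_of_normal_left.1 hs
  -- The two factorizations l u = l' v differ by a commutator lying in the product of the two
  -- kernels; splitting it as p q over the kernels shows how to correct l.
  have hmem : l⁻¹ * l' ∈ ⁅(⊤ : Subgroup (FreeGroup ι)), ⊤⁆ ⊓ identify o (r ⊔ s) := by
    refine ⟨Subgroup.mul_mem _ (Subgroup.inv_mem _ hl) hl', ?_⟩
    have : l⁻¹ * l' = u * v⁻¹ := by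
      rw [eq_mul_inv_iff_mul_eq, mul_assoc, h, inv_mul_cancel_left]
    rw [this, identify_sup]
    exact Subgroup.mul_mem_sup hu (inv_mem hv)
  have h2 := commutator_inf_identify_le o (r ⊔ s) ⊤ (top_sup_eq _) hmem
  rw [identify_sup] at h2
  obtain ⟨p, hp, q, hq, hpq⟩ := Subgroup.mem_sup_of_normal_left.1
    (Subgroup.commutator_sup_le _ _ _ h2)
  refine ⟨p⁻¹ * l⁻¹, ?_, ?_, ?_⟩
  · exact Subgroup.mul_mem _ (Subgroup.inv_mem _ (Subgroup.commutator_mono le_rfl le_top hp))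
      (Subgroup.inv_mem _ hl)
  · have : p⁻¹ * l⁻¹ * (l * u) = p⁻¹ * u := by group
    rw [this]
    exact Subgroup.mul_mem _ (Subgroup.inv_mem _ (Subgroup.commutator_le_right _ _ hp)) hu
  · have : p⁻¹ * l⁻¹ * (l * u) = q * v := by
      rw [← h, mul_assoc, ← mul_assoc l⁻¹, ← hpq]; group
    rw [this]
    exact mul_mem (Subgroup.commutator_le_right _ _ hq) hv

/-- Connectivity makes `identify o r` a supplement to the other two kernels together, so the
retraction bound applies; the commutator with the third kernel is absorbed by that kernel. -/
theorem commutator_inf_sup_identify_le (o : ι) (r s t : Setoid ι) (h : r ⊔ s ⊔ t = ⊤) :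
    ⁅identify o r, identify o r⁆ ⊓ (identify o s ⊔ identify o t) ≤
      ⁅identify o r, identify o s⁆ ⊔ identify o t := by
  have hX : identify o r ⊔ identify o (s ⊔ t) = ⊤ := by
    rw [← identify_sup, ← sup_assoc, h, identify_top]
  have := commutator_inf_identify_le o (s ⊔ t) (identify o r) hX
  rw [identify_sup] at this
  exact this.trans ((Subgroup.commutator_sup_le _ _ _).trans
    (sup_le_sup le_rfl (Subgroup.commutator_le_right _ _)))

/-- For three equivalence relations generating the full relation, an element which is trivial modulo
commutators in each of the three free quotients is, up to commutators, trivial in all of them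
simultaneously. -/
theorem exists_mem_inf_inf_identify (o : ι) (r s t : Setoid ι) (h : r ⊔ s ⊔ t = ⊤)
    {w : FreeGroup ι}
    (hr : w ∈ commutator (FreeGroup ι) ⊔ identify o r)
    (hs : w ∈ commutator (FreeGroup ι) ⊔ identify o s)
    (ht : w ∈ commutator (FreeGroup ι) ⊔ identify o t) :
    ∃ k ∈ commutator (FreeGroup ι), k * w ∈ identify o r ⊓ identify o s ⊓ identify o t := by
  obtain ⟨k, hk, hkr, hks⟩ := exists_mem_inf_identify o r s hr hs
  set A := identify o r
  set B := identify o s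
  set C := identify o t
  have hkt : k * w ∈ commutator (FreeGroup ι) ⊔ C :=
    mul_mem (le_sup_left (b := C) hk) ht
  obtain ⟨l, hl, c, hc, hlc⟩ := Subgroup.mem_sup_of_normal_left.1 hkt
  have htop : A ⊔ B ⊔ C = ⊤ := by
    rw [← identify_sup, ← identify_sup, h, identify_top]
  -- Expand [ABC, ABC] bilinearly: every term involving C falls into C, leaving [A,A], [B,B] and
  -- [A,B].
  have hcomm : commutator (FreeGroup ι) ≤ ⁅A, A⁆ ⊔ (⁅B, B⁆ ⊔ (⁅A, B⁆ ⊔ C)) := by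
    have hAC : ⁅A ⊔ B ⊔ C, C⁆ ≤ C := Subgroup.commutator_le_right _ _
    have hA : ⁅A ⊔ B ⊔ C, A⁆ ≤ ⁅A, A⁆ ⊔ (⁅B, B⁆ ⊔ (⁅A, B⁆ ⊔ C)) := by
      rw [Subgroup.commutator_comm]
      refine (Subgroup.commutator_sup_le _ _ _).trans (sup_le
        ((Subgroup.commutator_sup_le _ _ _).trans (sup_le le_sup_left ?_))
        ((Subgroup.commutator_le_right _ _).trans ?_))
      · exact le_sup_of_le_right (le_sup_of_le_right le_sup_left)
      · exact le_sup_of_le_right (le_sup_of_le_right le_sup_right)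
    have hB : ⁅A ⊔ B ⊔ C, B⁆ ≤ ⁅A, A⁆ ⊔ (⁅B, B⁆ ⊔ (⁅A, B⁆ ⊔ C)) := by
      rw [Subgroup.commutator_comm]
      refine (Subgroup.commutator_sup_le _ _ _).trans (sup_le
        ((Subgroup.commutator_sup_le _ _ _).trans (sup_le ?_ ?_))
        ((Subgroup.commutator_le_right _ _).trans ?_))
      · rw [Subgroup.commutator_comm]
        exact le_sup_of_le_right (le_sup_of_le_right le_sup_left)
      · exact le_sup_of_le_right le_sup_left
      · exact le_sup_of_le_right (le_sup_of_le_right le_sup_right)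
    have hdef : commutator (FreeGroup ι) = ⁅A ⊔ B ⊔ C, A ⊔ B ⊔ C⁆ := by
      rw [htop]; rfl
    rw [hdef]
    refine (Subgroup.commutator_sup_le _ _ _).trans (sup_le
      ((Subgroup.commutator_sup_le _ _ _).trans (sup_le hA hB)) (hAC.trans ?_))
    exact le_sup_of_le_right (le_sup_of_le_right le_sup_right)
  obtain ⟨α, hα, y, hy, rfl⟩ := Subgroup.mem_sup_of_normal_left.1 (hcomm hl)
  obtain ⟨β, hβ, τ, hτ, rfl⟩ := Subgroup.mem_sup_of_normal_left.1 hy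
  have hαA : α ∈ A := Subgroup.commutator_le_right _ _ hα
  have hβB : β ∈ B := Subgroup.commutator_le_right _ _ hβ
  have hTA : ⁅A, B⁆ ⊔ C ≤ A ⊔ C := sup_le_sup (Subgroup.commutator_le_left _ _) le_rfl
  have hTB : ⁅A, B⁆ ⊔ C ≤ B ⊔ C := sup_le_sup (Subgroup.commutator_le_right _ _) le_rfl
  -- All other factors of k w = α β τ c lie in AC, and k w lies in A, so β is in [B,B] ∩ AC;
  -- symmetrically α is in [A,A] ∩ BC.
  have hβT : β ∈ ⁅A, B⁆ ⊔ C := by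
    have hmem : β ∈ A ⊔ C := by
      have : β = α⁻¹ * (k * w) * c⁻¹ * τ⁻¹ := by rw [← hlc]; group
      rw [this]
      exact mul_mem (mul_mem (mul_mem (inv_mem (le_sup_left (b := C) hαA))
        (le_sup_left (b := C) hkr)) (inv_mem (le_sup_right (a := A) hc))) (inv_mem (hTA hτ))
    rw [Subgroup.commutator_comm]
    exact commutator_inf_sup_identify_le o s r t (by rwa [sup_comm s r]) ⟨hβ, hmem⟩
  have hαT : α ∈ ⁅A, B⁆ ⊔ C := by
    have hmem : α ∈ B ⊔ C := by
      have : α = (k * w) * c⁻¹ * τ⁻¹ * β⁻¹ := by rw [← hlc]; group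
      rw [this]
      exact mul_mem (mul_mem (mul_mem (le_sup_left (b := C) hks)
        (inv_mem (le_sup_right (a := B) hc))) (inv_mem (hTB hτ)))
        (inv_mem (le_sup_left (b := C) hβB))
    exact commutator_inf_sup_identify_le o r s t h ⟨hα, hmem⟩
  have hT : k * w ∈ ⁅A, B⁆ ⊔ C := by
    rw [← hlc]
    exact mul_mem (mul_mem hαT (mul_mem hβT hτ)) (le_sup_right (a := ⁅A, B⁆) hc)
  -- Since p is in [A,B] ≤ A ∩ B, removing it puts the word in C without leaving A ∩ B.
  obtain ⟨p, hp, d, hd, hpd⟩ := Subgroup.mem_sup_of_normal_left.1 hT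
  have hpw : p⁻¹ * k * w = d := by rw [mul_assoc, ← hpd, inv_mul_cancel_left]
  refine ⟨p⁻¹ * k, Subgroup.mul_mem _
    (Subgroup.inv_mem _ (Subgroup.commutator_mono le_top le_top hp)) hk,
    ⟨?_, ?_⟩, ?_⟩
  · rw [mul_assoc]
    exact Subgroup.mul_mem _ (Subgroup.inv_mem _ (Subgroup.commutator_le_left _ _ hp)) hkr
  · rw [mul_assoc]
    exact Subgroup.mul_mem _ (Subgroup.inv_mem _ (Subgroup.commutator_le_right _ _ hp)) hks
  · rwa [hpw]

end FreeGroup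

/-! ### Words with prescribed exponent sums -/

namespace FreeGroup

variable {ι : Type*} [Fintype ι]

/-- `w` has exponent sum `z i` in the generator `i`. -/
def HasExponents (w : FreeGroup ι) (z : ι → ℤ) : Prop :=
  Abelianization.of w = ∏ i, Abelianization.of (of i) ^ z i

theorem exists_hasExponents (z : ι → ℤ) : ∃ w : FreeGroup ι, w.HasExponents z := by
  refine ⟨(Finset.univ.toList.map fun i => of i ^ z i).prod, ?_⟩
  rw [HasExponents, map_list_prod, List.map_map, ← Finset.prod_map_toList]
  congr 1

theorem HasExponents.map_eq {w : FreeGroup ι} {z : ι → ℤ} (hw : w.HasExponents z) {M : Type*}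
    [CommGroup M] (f : FreeGroup ι →* M) : f w = ∏ i, f (of i) ^ z i := by
  have h := congrArg (Abelianization.lift f) hw
  simpa only [map_prod, map_zpow, Abelianization.lift_apply_of] using h

theorem HasExponents.commutator_mul {w k : FreeGroup ι} {z : ι → ℤ} (hw : w.HasExponents z)
    (hk : k ∈ commutator (FreeGroup ι)) : (k * w).HasExponents z := by
  rw [← Abelianization.ker_of] at hk
  rw [HasExponents, _root_.map_mul, MonoidHom.mem_ker.1 hk, one_mul]
  exact hw

/-- A product of powers vanishes if the bases depend only on `a i` and the exponents sum to zero
over each fibre of `a`. -/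
theorem _root_.Finset.prod_zpow_eq_one_of_fiberwise {A M : Type*} [CommGroup M] {a : ι → A}
    {z : ι → ℤ} (hz : ∀ f : A → ℤ, ∑ i, z i * f (a i) = 0) {g : ι → M}
    (hg : ∀ i j, a i = a j → g i = g j) : ∏ i, g i ^ z i = 1 := by
  classical
  rw [← Finset.prod_fiberwise_of_maps_to (t := Finset.univ.image a)
    (fun i _ => Finset.mem_image_of_mem a (Finset.mem_univ i))]
  refine Finset.prod_eq_one fun k hk => ?_
  obtain ⟨i₀, -, rfl⟩ := Finset.mem_image.1 hk
  have h1 : ∀ i ∈ Finset.univ.filter (fun i => a i = a i₀), g i ^ z i = g i₀ ^ z i := by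
    intro i hi
    rw [hg i i₀ (Finset.mem_filter.1 hi).2]
  -- The indicator of one value of a extracts the sum over that fibre.
  have h2 := hz (Pi.single (a i₀) 1)
  simp only [Pi.single_apply, mul_ite, mul_one, mul_zero] at h2
  have h3 := map_sum (zpowersHom M (g i₀)).toAdditiveRight z
    (Finset.univ.filter (fun i => a i = a i₀))
  rw [Finset.sum_filter, h2] at h3
  rw [Finset.prod_congr rfl h1]
  simpa using (congrArg Additive.toMul h3).symm

/-- In the abelianized quotient, generators in one fibre of a coincide and their total exponent is
0. -/
theorem HasExponents.mem_commutator_sup_identify {A : Type*} (o : ι) {a : ι → A} {z : ι → ℤ}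
    {w : FreeGroup ι} (hw : w.HasExponents z) (hz : ∀ f : A → ℤ, ∑ i, z i * f (a i) = 0) :
    w ∈ commutator (FreeGroup ι) ⊔ identify o (Setoid.ker a) := by
  set T := identify o (Setoid.ker a)
  let q := QuotientGroup.mk' T
  have h1 : (Abelianization.of.comp q) w = 1 := by
    rw [hw.map_eq]
    refine Finset.prod_zpow_eq_one_of_fiberwise hz fun i j hij => ?_
    have : q (of i) = q (of j) := QuotientGroup.eq.2 (inv_mul_mem_identify o hij)
    rw [MonoidHom.comp_apply, MonoidHom.comp_apply, this]
  have h2 : q w ∈ commutator (FreeGroup ι ⧸ T) := by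
    rw [← Abelianization.ker_of]
    exact h1
  have h3 : commutator (FreeGroup ι ⧸ T) = (commutator (FreeGroup ι)).map q := by
    rw [commutator_def, commutator_def, Subgroup.map_commutator,
      Subgroup.map_top_of_surjective q (QuotientGroup.mk'_surjective T)]
  rw [h3] at h2
  have h4 := Subgroup.comap_map_eq q (commutator (FreeGroup ι))
  rw [QuotientGroup.ker_mk'] at h4
  rw [← h4]
  exact h2

/-- If the integers `z i` sum to zero over each class of three partitions of `ι` that together
connect `ι`, then they are the exponent sums of a word that vanishes in each of the three free
quotients given by the partitions. -/
theorem exists_hasExponents_mem_identify {A B C : Type*} (o : ι) (a : ι → A) (b : ι → B)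
    (c : ι → C) (hconn : Setoid.ker a ⊔ Setoid.ker b ⊔ Setoid.ker c = ⊤) (z : ι → ℤ)
    (ha : ∀ f : A → ℤ, ∑ i, z i * f (a i) = 0) (hb : ∀ f : B → ℤ, ∑ i, z i * f (b i) = 0)
    (hc : ∀ f : C → ℤ, ∑ i, z i * f (c i) = 0) :
    ∃ w ∈ identify o (Setoid.ker a) ⊓ identify o (Setoid.ker b) ⊓ identify o (Setoid.ker c),
      w.HasExponents z := by
  obtain ⟨w, hw⟩ := exists_hasExponents z
  obtain ⟨k, hk, hkw⟩ := exists_mem_inf_inf_identify o _ _ _ hconn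
    (hw.mem_commutator_sup_identify o ha) (hw.mem_commutator_sup_identify o hb)
    (hw.mem_commutator_sup_identify o hc)
  exact ⟨k * w, hkw, hw.commutator_mul hk⟩

theorem commute_lift {κ κ' M : Type*} [Group M] {f : κ → M} {g : κ' → M}
    (h : ∀ i j, Commute (f i) (g j)) (u : FreeGroup κ) (v : FreeGroup κ') :
    Commute (lift f u) (lift g v) := by
  have h1 : ∀ i, Commute (f i) (lift g v) := fun i => by
    induction v using FreeGroup.induction_on with
    | C1 => simp
    | of j => simpa using h i j
    | inv_of j hj => simpa using hj
    | mul x y hx hy => simpa using hx.mul_right hy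
  induction u using FreeGroup.induction_on with
  | C1 => simp
  | of i => simpa using h1 i
  | inv_of i hi => simpa using hi
  | mul x y hx hy => simpa using hx.mul_left hy

end FreeGroup

/-! ### The game group and its abelian even quotient -/

namespace ThreeXORGame

open scoped commutatorElement

variable {N m : ℕ}

theorem x_mul_self (α : Fin 3) (i : Fin N) : x α i * x α i = 1 := by
  have key : PresentedGroup.mk (rels N) (FreeGroup.of (Gen.x α i) ^ 2) = 1 :=
    PresentedGroup.one_of_mem (Or.inl (Or.inl (Or.inl ⟨α, i, rfl⟩)))
  rw [map_pow, pow_two] at key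
  exact key

theorem sigma_sq (N : ℕ) : sigma N ^ 2 = 1 := by
  have key : PresentedGroup.mk (rels N) (FreeGroup.of Gen.sigma ^ 2) = 1 :=
    PresentedGroup.one_of_mem (Or.inl (Or.inr rfl))
  rwa [map_pow] at key

/-- Homomorphisms out of the game group. -/
theorem exists_hom {M : Type*} [Group M] (f : Fin 3 → Fin N → M) (t : M)
    (h1 : ∀ α i, f α i ^ 2 = 1) (h2 : ∀ α β i j, α ≠ β → Commute (f α i) (f β j)) (h3 : t ^ 2 = 1)
    (h4 : ∀ α i, Commute t (f α i)) :
    ∃ φ : GameGroup N →* M, (∀ α i, φ (x α i) = f α i) ∧ φ (sigma N) = t := by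
  let g : Gen N → M := fun | Gen.x α i => f α i | Gen.sigma => t
  have hg : ∀ r ∈ rels N, FreeGroup.lift g r = 1 := by
    rintro r (((⟨α, i, rfl⟩ | ⟨α, β, i, j, h, rfl⟩) | rfl) | ⟨α, i, rfl⟩)
    · simpa [g] using h1 α i
    · rw [map_commutatorElement, commutatorElement_eq_one_iff_commute]
      simpa [g] using h2 α β i j h
    · simpa [g] using h3
    · rw [map_commutatorElement, commutatorElement_eq_one_iff_commute]
      simpa [g] using h4 α i
  refine ⟨PresentedGroup.toGroup hg, fun α i => ?_, ?_⟩
  · exact PresentedGroup.toGroup.of hg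
  · exact PresentedGroup.toGroup.of hg

/-- Pairs of the same player commute by the choice of K, pairs of different players commute in G,
and σ is central. -/
theorem evenGroup_quotient_comm (u v : evenGroup N ⧸ K N) : u * v = v * u := by
  let q := QuotientGroup.mk' (K N)
  let S : Set (GameGroup N) := {g | ∃ (α : Fin 3) (i j : Fin N), g = x α i * x α j} ∪ {sigma N}
  have hgen : ∀ g h : evenGroup N, (g : GameGroup N) ∈ S → (h : GameGroup N) ∈ S →
      Commute (q g) (q h) := by
    have hσ : ∀ g h : evenGroup N, (g : GameGroup N) = sigma N → (h : GameGroup N) ∈ S →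
        Commute g h := by
      intro g h hg hh
      refine Subtype.ext ?_
      rcases hh with ⟨β, k, l, hh⟩ | hh
      · simpa [hg, hh] using ((commute_sigma_x β k).mul_right (commute_sigma_x β l)).eq
      · rw [Set.mem_singleton_iff] at hh
        simp [hg, hh]
    intro g h hg hh
    rcases hg with ⟨α, i, j, hg⟩ | hg
    · rcases hh with ⟨β, k, l, hh⟩ | hh
      · obtain rfl : g = evenPair α i j := Subtype.ext hg
        obtain rfl : h = evenPair β k l := Subtype.ext hh
        by_cases hαβ : α = β
        · subst hαβ
          rw [← commutatorElement_eq_one_iff_commute, ← map_commutatorElement]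
          exact (QuotientGroup.eq_one_iff _).2
            (Subgroup.subset_normalClosure ⟨α, i, j, k, l, rfl⟩)
        · refine Commute.map (f := q) (Subtype.ext ?_)
          have := fun i j => commute_x (N := N) hαβ i j
          exact (((this i k).mul_right (this i l)).mul_left ((this j k).mul_right (this j l))).eq
      · exact ((hσ h g hh (Or.inl ⟨α, i, j, hg⟩)).map q).symm
    · exact (hσ g h hg hh).map q
  have htop : Subgroup.closure ((↑) ⁻¹' S : Set (evenGroup N)) = ⊤ :=
    Subgroup.closure_closure_coe_preimage
  have step : ∀ h : evenGroup N, (∀ g : evenGroup N, (g : GameGroup N) ∈ S →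
      Commute (q g) (q h)) → ∀ g, Commute (q g) (q h) := by
    intro h hh g
    have hg : g ∈ Subgroup.closure ((↑) ⁻¹' S : Set (evenGroup N)) := htop ▸ Subgroup.mem_top g
    induction hg using Subgroup.closure_induction with
    | mem y hy => exact hh y hy
    | one => simp
    | mul y y' _ _ hy hy' => simpa using hy.mul_left hy'
    | inv y _ hy => simpa using hy
  obtain ⟨u, rfl⟩ := QuotientGroup.mk'_surjective (K N) u
  obtain ⟨v, rfl⟩ := QuotientGroup.mk'_surjective (K N) v
  exact step v (fun g hg => (step g (fun h hh => hgen h g hh hg) v).symm) u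

/-! ### Clauses and the parity character -/

variable (Γ : ThreeXORGame N m)

theorem clause_mul_clause (i j : Fin m) : Γ.clause i * Γ.clause j =
    (x 0 (Γ.a i) * x 0 (Γ.a j)) * (x 1 (Γ.b i) * x 1 (Γ.b j)) *
      (x 2 (Γ.c i) * x 2 (Γ.c j)) * (sigma N ^ (Γ.s i : ℕ) * sigma N ^ (Γ.s j : ℕ)) := by
  have hσ : ∀ (α : Fin 3) (k : Fin N),
      Commute (sigma N ^ (Γ.s i : ℕ)) (x α k) := fun α k => (commute_sigma_x α k).pow_left _
  unfold clause
  have h10 := (commute_x (show (1 : Fin 3) ≠ 0 by decide) (Γ.b i) (Γ.a j)).eq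
  have h20 := (commute_x (show (2 : Fin 3) ≠ 0 by decide) (Γ.c i) (Γ.a j)).eq
  have h21 := (commute_x (show (2 : Fin 3) ≠ 1 by decide) (Γ.c i) (Γ.b j)).eq
  calc _ = x 0 (Γ.a i) * x 1 (Γ.b i) * x 2 (Γ.c i) *
        (sigma N ^ (Γ.s i : ℕ) * (x 0 (Γ.a j) * x 1 (Γ.b j) * x 2 (Γ.c j))) *
        sigma N ^ (Γ.s j : ℕ) := by simp only [mul_assoc]
    _ = x 0 (Γ.a i) * (x 1 (Γ.b i) * (x 2 (Γ.c i) * x 0 (Γ.a j)) * x 1 (Γ.b j)) *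
        x 2 (Γ.c j) * (sigma N ^ (Γ.s i : ℕ) * sigma N ^ (Γ.s j : ℕ)) := by
      rw [(((hσ 0 (Γ.a j)).mul_right (hσ 1 (Γ.b j))).mul_right (hσ 2 (Γ.c j))).eq]
      simp only [mul_assoc]
    _ = x 0 (Γ.a i) * ((x 1 (Γ.b i) * x 0 (Γ.a j)) * (x 2 (Γ.c i) * x 1 (Γ.b j))) *
        x 2 (Γ.c j) * (sigma N ^ (Γ.s i : ℕ) * sigma N ^ (Γ.s j : ℕ)) := by
      rw [h20]; simp only [mul_assoc]
    _ = _ := by rw [h10, h21]; simp only [mul_assoc]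

theorem clause_mul_self (i : Fin m) : Γ.clause i * Γ.clause i = 1 := by
  rw [clause_mul_clause, x_mul_self, x_mul_self, x_mul_self, ← pow_add, ← two_mul, pow_mul,
    sigma_sq]
  simp

/-- The homomorphism whose kernel on the clause group consists of the even elements. -/
theorem exists_parity (N : ℕ) : ∃ φ : GameGroup N →* ℤˣ, φ (sigma N) = 1 ∧
    ∀ (m : ℕ) (Γ : ThreeXORGame N m) (i : Fin m), φ (Γ.clause i) = -1 := by
  -- Only the generators of player 0 are given sign -1; each clause contains exactly one of them.
  obtain ⟨φ, h1, h2⟩ := exists_hom (N := N) (fun α _ => if α = 0 then (-1 : ℤˣ) else 1) 1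
    (fun α i => Int.units_sq _) (fun _ _ _ _ _ => Commute.all _ _) (Int.units_sq _)
    (fun _ _ => Commute.all _ _)
  exact ⟨φ, h2, fun m Γ i => by simp [clause, h1, h2]⟩

/-- Since clauses are involutions, H is the union of H^E and the sets h_i H^E. The parity character
is 1 on σ and on H^E but -1 on h_i, which excludes the second case. -/
theorem sigma_mem_evenClauseGroup (h : sigma N ∈ Γ.clauseGroup) :
    sigma N ∈ Γ.evenClauseGroup := by
  have key : ∀ g ∈ Γ.clauseGroup, g ∈ Γ.evenClauseGroup ∨
      ∃ i, Γ.clause i * g ∈ Γ.evenClauseGroup := by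
    have hinv : ∀ i, (Γ.clause i)⁻¹ = Γ.clause i := fun i =>
      inv_eq_of_mul_eq_one_left (Γ.clause_mul_self i)
    have hstep : ∀ j y, (y ∈ Γ.evenClauseGroup ∨ ∃ i, Γ.clause i * y ∈ Γ.evenClauseGroup) →
        (Γ.clause j * y ∈ Γ.evenClauseGroup ∨
          ∃ i, Γ.clause i * (Γ.clause j * y) ∈ Γ.evenClauseGroup) := by
      rintro j y (hy | ⟨i, hy⟩)
      · exact Or.inr ⟨j, by rwa [← mul_assoc, clause_mul_self, one_mul]⟩
      · left
        have : Γ.clause j * y = (Γ.clause j * Γ.clause i) * (Γ.clause i * y) := by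
          rw [mul_assoc, ← mul_assoc (Γ.clause i), clause_mul_self, one_mul]
        rw [this]
        exact mul_mem (Subgroup.subset_closure ⟨j, i, rfl⟩) hy
    intro g hg
    induction hg using Subgroup.closure_induction_left with
    | one => exact Or.inl (one_mem _)
    | mul_left _ hx y _ hy =>
      obtain ⟨j, rfl⟩ := hx
      exact hstep j y hy
    | inv_mul_cancel _ hx y _ hy =>
      obtain ⟨j, rfl⟩ := hx
      rw [hinv]
      exact hstep j y hy
  rcases key _ h with h | ⟨i, hi⟩
  · exact h
  · obtain ⟨φ, hφσ, hφ⟩ := exists_parity N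
    have hle : Γ.evenClauseGroup ≤ φ.ker := by
      rw [evenClauseGroup, Subgroup.closure_le]
      rintro _ ⟨i, j, rfl⟩
      simp [MonoidHom.mem_ker, hφ]
    have := hle hi
    rw [MonoidHom.mem_ker, map_mul, hφσ, hφ] at this
    simp at this

/-! ### Evaluating words in the clauses -/

/-- The word in the free group on the clauses, evaluated with the `i`-th generator standing for
`h_o h_i`. -/
theorem lift_mem_clauseGroup (o : Fin m) (w : FreeGroup (Fin m)) :
    FreeGroup.lift (fun i => Γ.clause o * Γ.clause i) w ∈ Γ.clauseGroup := by
  induction w using FreeGroup.induction_on with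
  | C1 => simp
  | of i =>
    rw [FreeGroup.lift_apply_of]
    exact mul_mem (Subgroup.subset_closure ⟨o, rfl⟩) (Subgroup.subset_closure ⟨i, rfl⟩)
  | inv_of i hi =>
    rw [map_inv]
    exact inv_mem hi
  | mul x y hx hy =>
    rw [map_mul]
    exact mul_mem hx hy

/-- The four families of values commute with one another, so their evaluations combine into one
homomorphism, which is compared on generators. Each player's word can then be cancelled separately.
-/
theorem lift_clause_eq (o : Fin m) (w : FreeGroup (Fin m)) :
    FreeGroup.lift (fun i => Γ.clause o * Γ.clause i) w =
      FreeGroup.lift (fun i => x 0 (Γ.a o) * x 0 (Γ.a i)) w *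
        FreeGroup.lift (fun i => x 1 (Γ.b o) * x 1 (Γ.b i)) w *
        FreeGroup.lift (fun i => x 2 (Γ.c o) * x 2 (Γ.c i)) w *
        FreeGroup.lift (fun i => sigma N ^ (Γ.s o : ℕ) * sigma N ^ (Γ.s i : ℕ)) w := by
  have hpair : ∀ {α β : Fin 3}, α ≠ β → ∀ i j k l : Fin N,
      Commute (x α i * x α j) (x β k * x β l) := fun h i j k l =>
    ((commute_x h i k).mul_right (commute_x h i l)).mul_left
      ((commute_x h j k).mul_right (commute_x h j l))
  have hσ : ∀ (α : Fin 3) (i j : Fin N) (k l : ℕ),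
      Commute (x α i * x α j) (sigma N ^ k * sigma N ^ l) := fun α i j k l => by
    rw [← pow_add]
    exact (((commute_sigma_x α i).mul_right (commute_sigma_x α j)).pow_left _).symm
  have h01 := FreeGroup.commute_lift (fun i j : Fin m =>
    hpair (show (0 : Fin 3) ≠ 1 by decide) (Γ.a o) (Γ.a i) (Γ.b o) (Γ.b j))
  have h02 := FreeGroup.commute_lift (fun i j : Fin m =>
    hpair (show (0 : Fin 3) ≠ 2 by decide) (Γ.a o) (Γ.a i) (Γ.c o) (Γ.c j))
  have h12 := FreeGroup.commute_lift (fun i j : Fin m =>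
    hpair (show (1 : Fin 3) ≠ 2 by decide) (Γ.b o) (Γ.b i) (Γ.c o) (Γ.c j))
  have h0 := FreeGroup.commute_lift (fun i j : Fin m => hσ 0 (Γ.a o) (Γ.a i) (Γ.s o) (Γ.s j))
  have h1 := FreeGroup.commute_lift (fun i j : Fin m => hσ 1 (Γ.b o) (Γ.b i) (Γ.s o) (Γ.s j))
  have h2 := FreeGroup.commute_lift (fun i j : Fin m => hσ 2 (Γ.c o) (Γ.c i) (Γ.s o) (Γ.s j))
  set A := FreeGroup.lift (fun i => x 0 (Γ.a o) * x 0 (Γ.a i))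
  set B := FreeGroup.lift (fun i => x 1 (Γ.b o) * x 1 (Γ.b i))
  set C := FreeGroup.lift (fun i => x 2 (Γ.c o) * x 2 (Γ.c i))
  set S := FreeGroup.lift (fun i => sigma N ^ (Γ.s o : ℕ) * sigma N ^ (Γ.s i : ℕ))
  let P := MonoidHom.noncommCoprod (MonoidHom.noncommCoprod (MonoidHom.noncommCoprod A B h01) C
    (fun u v => (h02 u.1 v).mul_left (h12 u.2 v))) S
    (fun u v => ((h0 u.1.1 v).mul_left (h1 u.1.2 v)).mul_left (h2 u.2 v))
  let D := P.comp (((MonoidHom.id (FreeGroup (Fin m))).prod (MonoidHom.id _)).prod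
    (MonoidHom.id _) |>.prod (MonoidHom.id _))
  have hD : FreeGroup.lift (fun i => Γ.clause o * Γ.clause i) = D := by
    refine FreeGroup.ext_hom _ _ fun i => ?_
    change _ = A (FreeGroup.of i) * B (FreeGroup.of i) * C (FreeGroup.of i) * S (FreeGroup.of i)
    simp only [A, B, C, S, FreeGroup.lift_apply_of, clause_mul_clause]
  rw [hD]
  rfl

theorem sigma_mem_of_connected
    (hconn : Setoid.ker Γ.a ⊔ Setoid.ker Γ.b ⊔ Setoid.ker Γ.c = ⊤) (z : Fin m → ℤ)
    (ha : ∀ f : Fin N → ℤ, ∑ i, z i * f (Γ.a i) = 0)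
    (hb : ∀ f : Fin N → ℤ, ∑ i, z i * f (Γ.b i) = 0)
    (hc : ∀ f : Fin N → ℤ, ∑ i, z i * f (Γ.c i) = 0)
    (hs : Odd (∑ i, z i * (Γ.s i : ℕ))) : sigma N ∈ Γ.clauseGroup := by
  obtain ⟨o⟩ : Nonempty (Fin m) := by
    by_contra hempty
    rw [not_nonempty_iff] at hempty
    simp at hs
  obtain ⟨w, ⟨⟨hwa, hwb⟩, hwc⟩, hw⟩ :=
    FreeGroup.exists_hasExponents_mem_identify o Γ.a Γ.b Γ.c hconn z ha hb hc
  -- The value at i depends only on q i and is an involution squared at i = o, so the evaluation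
  -- factors through the free quotient.
  have hvanish : ∀ (α : Fin 3) (q : Fin m → Fin N),
      w ∈ FreeGroup.identify o (Setoid.ker q) →
      FreeGroup.lift (fun i => x α (q o) * x α (q i)) w = 1 := by
    intro α q hq
    refine FreeGroup.identify_le_ker _ ?_ (fun i j hij => ?_) hq
    · simp [x_mul_self]
    · rw [FreeGroup.lift_apply_of, FreeGroup.lift_apply_of, show q i = q j from hij]
  have hσ : FreeGroup.lift (fun i => sigma N ^ (Γ.s o : ℕ) * sigma N ^ (Γ.s i : ℕ)) w =
      sigma N := by
    let χ : FreeGroup (Fin m) →* Multiplicative ℤ :=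
      FreeGroup.lift fun i => Multiplicative.ofAdd ((Γ.s o : ℕ) + (Γ.s i : ℕ) : ℤ)
    have h1 : FreeGroup.lift (fun i => sigma N ^ (Γ.s o : ℕ) * sigma N ^ (Γ.s i : ℕ)) =
        (zpowersHom (GameGroup N) (sigma N)).comp χ := by
      ext i
      simp [χ, zpow_add]
    have h2 : (χ w).toAdd = ∑ i, z i * (Γ.s i : ℕ) := by
      rw [hw.map_eq]
      -- A constant test function gives ∑ z_i = 0, so the base clause contributes nothing to the
      -- exponent of σ.
      have h0 : ∑ i, z i * ((Γ.s o : ℕ) : ℤ) = 0 := ha fun _ => ((Γ.s o : ℕ) : ℤ)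
      simp [χ, toAdd_prod, mul_add, Finset.sum_add_distrib, h0]
    obtain ⟨k, hk⟩ := hs
    rw [h1, MonoidHom.comp_apply, zpowersHom_apply, h2, hk, zpow_add, zpow_mul, zpow_one]
    have : sigma N ^ (2 : ℤ) = 1 := mod_cast sigma_sq N
    rw [this, one_zpow, one_mul]
  have h := Γ.lift_mem_clauseGroup o w
  rwa [lift_clause_eq, hvanish 0 _ hwa, hvanish 1 _ hwb, hvanish 2 _ hwc, hσ, one_mul, one_mul,
    one_mul] at h

/-- The game in which every clause is replaced by the one with index `ρ i`. -/
def reindex (ρ : Fin m → Fin m) : ThreeXORGame N m :=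
  ⟨Γ.a ∘ ρ, Γ.b ∘ ρ, Γ.c ∘ ρ, Γ.s ∘ ρ⟩

theorem clauseGroup_reindex_le (ρ : Fin m → Fin m) :
    (Γ.reindex ρ).clauseGroup ≤ Γ.clauseGroup := by
  rw [clauseGroup, Subgroup.closure_le]
  rintro _ ⟨i, rfl⟩
  exact Subgroup.subset_closure ⟨ρ i, rfl⟩

/-- The odd sum splits over connected components, so some component has odd sum. Clauses outside it
are replaced by copies of the clause i₀ inside it, with exponent 0, which makes the game connected.
-/
theorem sigma_mem_of_exponents (z : Fin m → ℤ)
    (ha : ∀ f : Fin N → ℤ, ∑ i, z i * f (Γ.a i) = 0)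
    (hb : ∀ f : Fin N → ℤ, ∑ i, z i * f (Γ.b i) = 0)
    (hc : ∀ f : Fin N → ℤ, ∑ i, z i * f (Γ.c i) = 0)
    (hs : Odd (∑ i, z i * (Γ.s i : ℕ))) : sigma N ∈ Γ.clauseGroup := by
  classical
  set R : Setoid (Fin m) := Setoid.ker Γ.a ⊔ Setoid.ker Γ.b ⊔ Setoid.ker Γ.c
  have hRa : Setoid.ker Γ.a ≤ R := le_sup_left.trans le_sup_left
  have hRb : Setoid.ker Γ.b ≤ R := le_sup_right.trans le_sup_left
  have hRc : Setoid.ker Γ.c ≤ R := le_sup_right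
  obtain ⟨i₀, hi₀⟩ : ∃ i₀, Odd (∑ i, if R i i₀ then z i * (Γ.s i : ℕ) else 0) := by
    have hfib := Finset.sum_fiberwise Finset.univ (Quotient.mk R) fun i => z i * (Γ.s i : ℕ)
    by_contra! hall
    refine Int.not_even_iff_odd.2 hs ?_
    rw [← hfib]
    refine Finset.even_sum _ fun k _ => ?_
    induction k using Quotient.inductionOn with
    | h i₀ =>
      rw [Finset.sum_filter]
      have := Int.not_odd_iff_even.1 (hall i₀)
      simpa only [Quotient.eq] using this
  let ρ : Fin m → Fin m := fun i => if R i i₀ then i else i₀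
  have hρ : ∀ i, R (ρ i) i₀ := fun i => by
    by_cases h : R i i₀
    · simp [ρ, h]
    · simp [ρ, h]
  have hρ' : ∀ i, R i i₀ → ρ i = i := fun i h => by simp [ρ, h]
  have hz : ∀ q : Fin m → Fin N, Setoid.ker q ≤ R → (∀ f : Fin N → ℤ, ∑ i, z i * f (q i) = 0) →
      ∀ f : Fin N → ℤ, ∑ i, (if R i i₀ then z i else 0) * f (q (ρ i)) = 0 := by
    intro q hq hzq f
    -- Cut f off to the questions asked inside the component: no clause outside shares such a
    -- question, so the hypothesis on z applies to the truncated sum.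
    refine Eq.trans (Finset.sum_congr rfl fun i _ => ?_)
      (hzq fun k => if ∃ j, R j i₀ ∧ q j = k then f k else 0)
    by_cases h : R i i₀
    · rw [if_pos h, hρ' i h, if_pos ⟨i, h, rfl⟩]
    · rw [if_neg h, if_neg, zero_mul, mul_zero]
      rintro ⟨j, hj, hji⟩
      exact h (R.trans (R.symm (hq hji)) hj)
  refine Γ.clauseGroup_reindex_le ρ (sigma_mem_of_connected (Γ.reindex ρ) ?_
    (fun i => if R i i₀ then z i else 0) (hz _ hRa ha) (hz _ hRb hb) (hz _ hRc hc) ?_)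
  · set R' := Setoid.ker (Γ.reindex ρ).a ⊔ Setoid.ker (Γ.reindex ρ).b ⊔
      Setoid.ker (Γ.reindex ρ).c
    have hstep : ∀ q : Fin m → Fin N, Setoid.ker q ≤ R → Setoid.ker (q ∘ ρ) ≤ R' →
        Setoid.ker q ≤ R'.comap ρ := by
      intro q hq hq' i j hij
      by_cases h : R i i₀
      · have hj : R j i₀ := R.trans (R.symm (hq hij)) h
        rw [Setoid.comap_rel, hρ' i h, hρ' j hj]
        refine hq' ?_
        change q (ρ i) = q (ρ j)
        rw [hρ' i h, hρ' j hj]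
        exact hij
      · have hj : ¬ R j i₀ := fun hj => h (R.trans (hq hij) hj)
        rw [Setoid.comap_rel, show ρ i = i₀ from if_neg h, show ρ j = i₀ from if_neg hj]
    have hle : R ≤ R'.comap ρ := sup_le (sup_le
      (hstep _ hRa (le_sup_left.trans le_sup_left))
      (hstep _ hRb (le_sup_right.trans le_sup_left))) (hstep _ hRc le_sup_right)
    have hρρ : ∀ i, R' i (ρ i) := fun i => by
      refine (le_sup_left.trans le_sup_left : Setoid.ker (Γ.reindex ρ).a ≤ R') ?_
      change Γ.a (ρ i) = Γ.a (ρ (ρ i))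
      rw [hρ' (ρ i) (hρ i)]
    have hbase : ∀ i, R' i (ρ i₀) := fun i => by
      have h := hle (hρ i)
      rw [Setoid.comap_rel, hρ' (ρ i) (hρ i)] at h
      exact R'.trans (hρρ i) h
    exact eq_top_iff.2 fun i j _ => R'.trans (hbase i) (R'.symm (hbase j))
  · convert hi₀ using 2 with i
    by_cases h : R i i₀
    · simp [h, reindex, hρ' i h]
    · simp [h]

/-! ### Exponents read off modulo K -/

/-- The alternating count of the questions to player `α`, weighted by `f`, as the translation part
of an action of the game group on `ℤ` in which `x_i^{(α)}` is the reflection `t ↦ f i - t`. -/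
theorem exists_reflection_hom (α : Fin 3) (f : Fin N → ℤ) :
    ∃ φ : GameGroup N →* Equiv.Perm ℤ, (∀ i, φ (x α i) = Equiv.subLeft (f i)) ∧
      (∀ β, β ≠ α → ∀ i, φ (x β i) = 1) ∧ φ (sigma N) = 1 := by
  obtain ⟨φ, h1, h2⟩ := exists_hom (N := N)
    (fun β i => if β = α then Equiv.subLeft (f i) else (1 : Equiv.Perm ℤ)) 1
    (fun β i => by
      split_ifs
      · ext t; simp [pow_two]
      · simp)
    (fun β γ i j h => by
      by_cases hβ : β = α
      · have : γ ≠ α := fun hγ => h (hβ.trans hγ.symm)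
        simp [this]
      · simp [hβ])
    (one_pow 2) (fun _ _ => Commute.one_left _)
  exact ⟨φ, fun i => by simp [h1], fun β hβ i => by simp [h1, hβ], h2⟩

/-- A homomorphism from the game group whose image on `G^E` is commutative kills `K`. -/
theorem map_K_eq_one {M : Type*} [Group M] (φ : GameGroup N →* M)
    (h : ∀ (α : Fin 3) (i j k l : Fin N),
      Commute (φ (x α i * x α j)) (φ (x α k * x α l)))
    {g : evenGroup N} (hg : g ∈ K N) : φ g = 1 := by
  have : K N ≤ (φ.comp (evenGroup N).subtype).ker := by
    refine Subgroup.normalClosure_le_normal ?_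
    rintro _ ⟨α, i, j, k, l, rfl⟩
    rw [SetLike.mem_coe, MonoidHom.mem_ker, map_commutatorElement,
      commutatorElement_eq_one_iff_commute]
    exact h α i j k l
  exact this hg

theorem sigma_mem_of_mem_evenClauseModK
    (h : (QuotientGroup.mk (evenSigma N) : evenGroup N ⧸ K N) ∈ Γ.evenClauseModK) :
    sigma N ∈ Γ.clauseGroup := by
  obtain ⟨g, hg, hgσ⟩ := h
  have hK : g⁻¹ * evenSigma N ∈ K N := QuotientGroup.eq.1 hgσ
  have hgH : (g : GameGroup N) ∈ Γ.evenClauseGroup := hg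
  let q : Fin 3 → Fin m → Fin N := ![Γ.a, Γ.b, Γ.c]
  choose T hTα hTβ hTσ using exists_reflection_hom (N := N)
  obtain ⟨ψ, hψx, hψσ⟩ := exists_hom (N := N) (fun _ _ => (1 : ℤˣ)) (-1)
    (fun _ _ => one_pow 2) (fun _ _ _ _ _ => Commute.all _ _) (Int.units_sq _)
    (fun _ _ => Commute.all _ _)
  have hclause : ∀ α f i, T α f (Γ.clause i) = Equiv.subLeft (f (q α i)) := by
    intro α f i
    fin_cases α <;> simp [clause, hTα, hTβ, hTσ, q]
  have hexp : ∀ y ∈ Γ.evenClauseGroup, ∃ z : Fin m → ℤ,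
      (∀ α (f : Fin N → ℤ), T α f y = Equiv.addRight (∑ i, z i * f (q α i))) ∧
      ψ y = (-1) ^ (∑ i, z i * ((Γ.s i : ℕ) : ℤ)) := by
    intro y hy
    induction hy using Subgroup.closure_induction with
    | mem y hy =>
      obtain ⟨i, j, rfl⟩ := hy
      -- A product of two reflections is translation by f (q α i) - f (q α j); for ψ the sign of the
      -- second exponent is immaterial.
      refine ⟨Pi.single i 1 - Pi.single j 1, fun α f => ?_, ?_⟩
      · rw [map_mul, hclause, hclause]
        ext t
        simp [sub_mul, Finset.sum_sub_distrib, Pi.single_apply]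
        ring
      · simp [sub_mul, Finset.sum_sub_distrib, Pi.single_apply, clause, hψx, hψσ, zpow_sub]
    | one => exact ⟨0, fun α f => by ext t; simp, by simp⟩
    | mul y y' _ _ hy hy' =>
      obtain ⟨z, h1, h2⟩ := hy
      obtain ⟨z', h1', h2'⟩ := hy'
      refine ⟨z + z', fun α f => ?_, ?_⟩
      · rw [map_mul, h1, h1']
        ext t
        simp [add_mul, Finset.sum_add_distrib]
        ring
      · simp [h2, h2', add_mul, Finset.sum_add_distrib, zpow_add]
    | inv y _ hy =>
      obtain ⟨z, h1, h2⟩ := hy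
      refine ⟨-z, fun α f => ?_, ?_⟩
      · rw [map_inv, h1]
        ext t
        simp [Equiv.Perm.inv_def]
      · simp [h2]
  obtain ⟨z, hz, hzs⟩ := hexp g hgH
  have hzero : ∀ α (f : Fin N → ℤ), ∑ i, z i * f (q α i) = 0 := by
    intro α f
    -- Even pairs act by translations, which commute, so K acts trivially; σ does too, hence g
    -- translates by 0.
    have h1 := map_K_eq_one (T α f) (fun β i j k l => by
      by_cases hβ : β = α
      · subst hβ
        rw [map_mul, map_mul, hTα, hTα, hTα, hTα]
        ext t
        simp
        ring
      · simp [hTβ α f β hβ]) hK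
    rw [Subgroup.coe_mul, Subgroup.coe_inv, map_mul, map_inv, hz,
      show ((evenSigma N : evenGroup N) : GameGroup N) = sigma N from rfl, hTσ, mul_one,
      inv_eq_one] at h1
    simpa using DFunLike.congr_fun h1 0
  refine Γ.sigma_mem_of_exponents z (hzero 0) (hzero 1) (hzero 2) ?_
  -- The sign ψ sees only σ, so ψ g = ψ σ = -1 and the sum of the z_i s_i cannot be even.
  have h2 := map_K_eq_one ψ (fun _ _ _ _ _ => Commute.all _ _) hK
  rw [Subgroup.coe_mul, Subgroup.coe_inv, map_mul, map_inv, hzs,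
    show ((evenSigma N : evenGroup N) : GameGroup N) = sigma N from rfl, hψσ] at h2
  by_contra hodd
  rw [Int.not_odd_iff_even] at hodd
  rw [hodd.neg_one_zpow] at h2
  simp at h2

end ThreeXORGame

theorem theorem2p6 {N m : ℕ} (Γ : ThreeXORGame N m) :
    (∀ u v : ThreeXORGame.evenGroup N ⧸ ThreeXORGame.K N, u * v = v * u) ∧
    (ThreeXORGame.sigma N ∈ Γ.clauseGroup ↔
      (QuotientGroup.mk (ThreeXORGame.evenSigma N) :
        ThreeXORGame.evenGroup N ⧸ ThreeXORGame.K N) ∈ Γ.evenClauseModK) := by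
  refine ⟨ThreeXORGame.evenGroup_quotient_comm, fun h => ?_,
    Γ.sigma_mem_of_mem_evenClauseModK⟩
  exact ⟨ThreeXORGame.evenSigma N, Γ.sigma_mem_evenClauseGroup h, rfl⟩
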